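/- Let $SO(3)$ be the group of orthogonal real $3\times 3$ matrices of determinant $1$, and let $G_3$ be the group, under composition, of all transformations $x \mapsto Ax+b$ of $\mathbb{R}^3$ with $A\in SO(3)$ and $b\in\mathbb{R}^3$, acting on $\mathbb{R}^3$ in the obvious way. A decomposition of a set $A$ into $n$ pieces ($n$ a natural number) is a family $A_1,\dots,A_n$ of nonempty, pairwise disjoint sets with $A=A_1\cup\dots\cup A_n$. For a group $G$ acting on a set $X$, two subsets $A,B\subseteq X$ are called $G$-equidecomposable, written $A\sim_G B$, if for some $n$ there are decompositions $A=A_1\cup\dots\cup A_n$ and $B=B_1\cup\dots\cup B_n$ and elements $g_1,\dots,g_n\in G$ such that $B_i=g_iA_i$ for all $i=1,\dots,n$. A nonempty subset $E\subseteq X$ is called $G$-paradoxical if there are sets $A,B$ with $E=A\cup B$, $A\cap B=\emptyset$, $A\sim_G E$ and $B\sim_G E$. **Theorem (The Banach--Tarski paradox).** The closed unit ball $\mathbb{B}^3=\{x\in\mathbb{R}^3 : \|x\|\le 1\}$ (with the Euclidean norm) is $G_3$-paradoxical. -/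

import Mathlib

namespace BanachTarski

/-- Euclidean three-space. -/
abbrev E3 : Type := EuclideanSpace ℝ (Fin 3)

/-- The group `G₃` of rigid transformations of `ℝ³`: all maps `x ↦ A x + b` with `A ∈ SO(3)`
and `b ∈ ℝ³`, as a subgroup of the group of all bijections of `ℝ³` under composition. -/
def G3 : Subgroup (Equiv.Perm E3) where
  carrier := {f | ∃ A ∈ Matrix.specialOrthogonalGroup (Fin 3) ℝ, ∃ b : E3,
    ∀ x, f x = Matrix.toEuclideanLin A x + b}
  one_mem' := ⟨1, one_mem _, 0, fun x => by simp⟩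
  mul_mem' := by
    rintro f g ⟨A, hA, a, hf⟩ ⟨B, hB, b, hg⟩
    refine ⟨A * B, mul_mem hA hB, Matrix.toEuclideanLin A b + a, fun x => ?_⟩
    rw [Equiv.Perm.mul_apply, hf, hg, map_add, add_assoc]
    simp [Matrix.toLpLin_apply]
  inv_mem' := by
    rintro f ⟨A, hA, a, hf⟩
    have hA' := Matrix.mem_specialOrthogonalGroup_iff.1 hA
    have h1 : A * A.transpose = 1 := (Matrix.mem_orthogonalGroup_iff (Fin 3) ℝ).1 hA'.1
    have h2 : A.transpose * A = 1 := (Matrix.mem_orthogonalGroup_iff' (Fin 3) ℝ).1 hA'.1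
    refine ⟨A.transpose, Matrix.mem_specialOrthogonalGroup_iff.2
      ⟨(Matrix.mem_orthogonalGroup_iff (Fin 3) ℝ).2 ?_, ?_⟩,
      -Matrix.toEuclideanLin A.transpose a, fun x => ?_⟩
    · simpa [Matrix.star_eq_conjTranspose] using h2
    · rw [Matrix.det_transpose]; exact hA'.2
    · rw [Equiv.Perm.inv_eq_iff_eq, hf]
      simp [Matrix.toLpLin_apply, h1, Matrix.mulVec_add, Matrix.mulVec_neg]

/-- `P 0, …, P (n - 1)` is a decomposition (a finite partition) of `A`: the sets are nonempty,
pairwise disjoint, and their union is `A`. -/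
def IsDecomposition {X : Type*} {n : ℕ} (P : Fin n → Set X) (A : Set X) : Prop :=
  (∀ i, (P i).Nonempty) ∧ (∀ i j, i ≠ j → Disjoint (P i) (P j)) ∧ ⋃ i, P i = A

/-- `A` and `B` are `G`-equidecomposable: they have decompositions `A = A₁ ∪ ⋯ ∪ Aₙ` and
`B = B₁ ∪ ⋯ ∪ Bₙ` and there are `gᵢ ∈ G` with `Bᵢ = gᵢ Aᵢ`. -/
def Equidecomposable (G : Type*) {X : Type*} [Group G] [MulAction G X] (A B : Set X) : Prop :=
  ∃ (n : ℕ) (P Q : Fin n → Set X) (g : Fin n → G),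
    IsDecomposition P A ∧ IsDecomposition Q B ∧ ∀ i, Q i = (fun x => g i • x) '' P i

/-- A nonempty set `E` is `G`-paradoxical: `E = A ∪ B` with `A ∩ B = ∅` and both `A` and `B`
`G`-equidecomposable with `E`. -/
def IsParadoxical (G : Type*) {X : Type*} [Group G] [MulAction G X] (E : Set X) : Prop :=
  E.Nonempty ∧ ∃ A B : Set X, E = A ∪ B ∧ A ∩ B = ∅ ∧
    Equidecomposable G A E ∧ Equidecomposable G B E

end BanachTarski

open Set

namespace BanachTarski

/-! ### Piecewise group actions and free actions -/

section Abstract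

variable {G X : Type*} [Group G] [MulAction G X]

/-! It suffices to find two piecewise-rigid injections of the ball into itself with disjoint images
(`ContainsTwoCopies`); a piecewise Schröder–Bernstein argument turns them into a paradox.

A free group of rank two acting freely supplies such maps (`containsTwoCopies_of_free`). Two
rotations with cosine 3/5 generate a free group because, modulo 5, five times each generator or
inverse has rank one and reduced products never vanish (`freeRot_injective`). They act freely on the
ball minus the countably many axes of nontrivial words.

By `ContainsTwoCopies.of_diff`, a remainder that embeds piecewise into the part already duplicated
can be absorbed. One rotation absorbs the axes without the origin (`exists_rotation_singularSet`); a
translation absorbs the origin. -/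

theorem isDecomposition_fiber {ι : Type*} {n : ℕ} (e : Fin n ≃ ι) {A : Set X} (s : A → ι)
    (hs : Function.Surjective s) :
    IsDecomposition (fun i => {x | ∃ h : x ∈ A, s ⟨x, h⟩ = e i}) A := by
  refine ⟨fun i => ?_, fun i j hij => ?_, ?_⟩
  · obtain ⟨⟨x, hx⟩, h⟩ := hs (e i)
    exact ⟨x, hx, h⟩
  · refine Set.disjoint_left.2 ?_
    rintro x ⟨h, h1⟩ ⟨h', h2⟩
    exact hij (e.injective (h1.symm.trans h2))
  · ext x
    simp only [mem_iUnion, mem_ofPred_eq]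
    exact ⟨fun ⟨_, h, _⟩ => h, fun h => ⟨e.symm (s ⟨x, h⟩), h, by simp⟩⟩

theorem Equidecomposable.symm {A B : Set X} (h : Equidecomposable G A B) :
    Equidecomposable G B A := by
  obtain ⟨n, P, Q, g, hP, hQ, hg⟩ := h
  refine ⟨n, Q, P, fun i => (g i)⁻¹, hQ, hP, fun i => ?_⟩
  rw [hg, image_image]
  simp

/-- A bijection which is piecewise given by finitely many group elements is an
equidecomposition. -/
theorem equidecomposable_of_bijOn {A B : Set X} {f : X → X} {S : Finset G}
    (hf : BijOn f A B) (hS : Equidecomp.IsDecompOn f A S) : Equidecomposable G A B := by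
  choose s hsS hs using fun x : A => hS x x.2
  have hfin : Finite (range s) :=
    Set.Finite.to_subtype <| S.finite_toSet.subset (by rintro _ ⟨x, rfl⟩; exact hsS x)
  let e : Fin (Nat.card (range s)) ≃ range s := (Finite.equivFin _).symm
  have hP := isDecomposition_fiber e (Set.rangeFactorization s) Set.rangeFactorization_surjective
  set P : Fin (Nat.card (range s)) → Set X :=
    fun i => {x | ∃ h : x ∈ A, Set.rangeFactorization s ⟨x, h⟩ = e i} with hPdef
  have himg : ∀ i, (fun x => (e i : G) • x) '' P i = f '' P i := fun i => by
    refine image_congr ?_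
    rintro x ⟨hx, h⟩
    rw [hs ⟨x, hx⟩, ← h]
    rfl
  have hPA : ∀ i, P i ⊆ A := fun i x hx => hx.1
  refine ⟨_, P, fun i => f '' P i, fun i => e i, hP, ⟨fun i => (hP.1 i).image f, ?_, ?_⟩,
    fun i => (himg i).symm⟩
  · exact fun i j hij => (hP.2.1 i j hij).image hf.injOn (hPA i) (hPA j)
  · rw [← image_iUnion, hP.2.2, hf.image_eq]

variable (G) in
/-- `A` contains two disjoint copies of itself, up to piecewise action of finitely many elements
of `G`. -/
def ContainsTwoCopies (A : Set X) : Prop :=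
  ∃ (f g : X → X) (S : Finset G), Equidecomp.IsDecompOn f A S ∧ Equidecomp.IsDecompOn g A S ∧
    MapsTo f A A ∧ MapsTo g A A ∧ InjOn f A ∧ InjOn g A ∧ ∀ x ∈ A, ∀ y ∈ A, f x ≠ g y

/-- A piecewise version of the Schröder–Bernstein theorem: a subset of `E` into which `E` embeds
piecewise is equidecomposable with `E`. -/
theorem equidecomposable_of_embedding {E B : Set X} (hBE : B ⊆ E) {g : X → X} {S : Finset G}
    (hS : Equidecomp.IsDecompOn g E S) (hm : MapsTo g E B) (hi : InjOn g E) :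
    Equidecomposable G E B := by
  classical
  -- The bijection agrees at each point with `g` or with the inverse of the inclusion, so its
  -- multipliers lie in `S` or equal 1.
  obtain ⟨h, hh, hr⟩ := Function.Embedding.schroeder_bernstein_of_rel
    (f := hm.restrict g E B) (g := Set.inclusion hBE) (hm.restrict_inj.2 hi)
    (Set.inclusion_injective hBE) (fun a b => ∃ s ∈ insert 1 S, (b : X) = s • (a : X))
    (fun a => by
      obtain ⟨s, hs, h⟩ := hS a a.2
      exact ⟨s, Finset.mem_insert_of_mem hs, h⟩)
    (fun b => ⟨1, Finset.mem_insert_self _ _, by simp⟩)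
  let F : X → X := fun x => if hx : x ∈ E then h ⟨x, hx⟩ else x
  have hF : ∀ x (hx : x ∈ E), F x = h ⟨x, hx⟩ := fun x hx => dif_pos hx
  refine equidecomposable_of_bijOn (f := F) (S := insert 1 S) ⟨?_, ?_, ?_⟩ ?_
  · intro x hx
    rw [hF x hx]
    exact (h _).2
  · intro x hx y hy hxy
    rw [hF x hx, hF y hy] at hxy
    exact congrArg Subtype.val (hh.1 (Subtype.ext hxy))
  · intro y hy
    obtain ⟨⟨x, hx⟩, h'⟩ := hh.2 ⟨y, hy⟩
    exact ⟨x, hx, by rw [hF x hx, h']⟩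
  · intro x hx
    obtain ⟨s, hs, h'⟩ := hr ⟨x, hx⟩
    exact ⟨s, hs, by rw [hF x hx, h']⟩

/-- The second half is the whole complement of the first image, so that the two exhaust `E`; it
contains the image of `g`, and Schröder–Bernstein applies. -/
theorem ContainsTwoCopies.isParadoxical {E : Set X} (hE : E.Nonempty)
    (h : ContainsTwoCopies G E) : IsParadoxical G E := by
  obtain ⟨f, g, S, hfS, hgS, hf, hg, hfi, hgi, hfg⟩ := h
  refine ⟨hE, f '' E, E \ f '' E, ?_, ?_, ?_, ?_⟩
  · rw [union_sdiff_cancel hf.image_subset]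
  · exact inter_sdiff_self _ _
  · exact (equidecomposable_of_bijOn hfi.bijOn_image hfS).symm
  · refine (equidecomposable_of_embedding sdiff_subset hgS (fun x hx => ⟨hg hx, ?_⟩) hgi).symm
    rintro ⟨y, hy, h⟩
    exact hfg y hy x hx h

/-- If `A ⊆ E` contains two copies of itself and the rest of `E` embeds piecewise into `A`, then
`E` contains two copies of itself. -/
theorem ContainsTwoCopies.of_diff {A E : Set X} (hAE : A ⊆ E) (h : ContainsTwoCopies G A)
    {k : X → X} {T : Finset G} (hkT : Equidecomp.IsDecompOn k (E \ A) T)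
    (hk : MapsTo k (E \ A) A) (hki : InjOn k (E \ A)) : ContainsTwoCopies G E := by
  classical
  obtain ⟨f, g, S, hfS, hgS, hf, hg, hfi, hgi, hfg⟩ := h
  -- The two copies inside `A` make room for `A` and for the remainder: `r` injects `E` into `A`,
  -- and `f ∘ r`, `g ∘ r` are the required maps.
  let r : X → X := fun x => if x ∈ A then f x else g (k x)
  have hr1 : ∀ x ∈ A, r x = f x := fun x hx => if_pos hx
  have hr2 : ∀ x ∉ A, r x = g (k x) := fun x hx => if_neg hx
  have hr : MapsTo r E A := by
    intro x hx
    by_cases hA : x ∈ A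
    · rw [hr1 x hA]; exact hf hA
    · rw [hr2 x hA]; exact hg (hk ⟨hx, hA⟩)
  have hri : InjOn r E := by
    intro x hx y hy hxy
    by_cases hxA : x ∈ A <;> by_cases hyA : y ∈ A
    · rw [hr1 x hxA, hr1 y hyA] at hxy
      exact hfi hxA hyA hxy
    · rw [hr1 x hxA, hr2 y hyA] at hxy
      exact absurd hxy (hfg _ hxA _ (hk ⟨hy, hyA⟩))
    · rw [hr2 x hxA, hr1 y hyA] at hxy
      exact absurd hxy.symm (hfg _ hyA _ (hk ⟨hx, hxA⟩))
    · rw [hr2 x hxA, hr2 y hyA] at hxy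
      exact hki ⟨hx, hxA⟩ ⟨hy, hyA⟩ (hgi (hk ⟨hx, hxA⟩) (hk ⟨hy, hyA⟩) hxy)
  let U : Finset G := S ∪ Finset.image₂ (· * ·) S T
  have hrU : Equidecomp.IsDecompOn r E U := by
    intro x hx
    by_cases hA : x ∈ A
    · obtain ⟨s, hs, h⟩ := hfS x hA
      exact ⟨s, Finset.mem_union_left _ hs, by rw [hr1 x hA, h]⟩
    · obtain ⟨t, ht, h⟩ := hkT x ⟨hx, hA⟩
      obtain ⟨s, hs, h'⟩ := hgS _ (hk ⟨hx, hA⟩)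
      exact ⟨s * t, Finset.mem_union_right _ (Finset.mem_image₂_of_mem hs ht),
        by rw [hr2 x hA, h', h, mul_smul]⟩
  have hcomp : ∀ p : X → X, Equidecomp.IsDecompOn p A S →
      Equidecomp.IsDecompOn (p ∘ r) E (Finset.image₂ (· * ·) S U) := by
    intro p hp x hx
    obtain ⟨u, hu, h⟩ := hrU x hx
    obtain ⟨s, hs, h'⟩ := hp _ (hr hx)
    exact ⟨s * u, Finset.mem_image₂_of_mem hs hu, by rw [Function.comp_apply, h', h, mul_smul]⟩
  exact ⟨f ∘ r, g ∘ r, Finset.image₂ (· * ·) S U, hcomp f hfS, hcomp g hgS,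
    fun x hx => hAE (hf (hr hx)), fun x hx => hAE (hg (hr hx)), hfi.comp hri hr, hgi.comp hri hr,
    fun x hx y hy => hfg _ (hr hx) _ (hr hy)⟩

/-- On an invariant set on which it acts freely, a group admits an equivariant map to itself. -/
theorem exists_equivariant {F : Type*} [Group F] [MulAction F X] {A : Set X}
    (hfree : ∀ x ∈ A, ∀ w : F, w • x = x → w = 1) (hinv : ∀ w : F, ∀ x ∈ A, w • x ∈ A) :
    ∃ c : X → F, ∀ w : F, ∀ x ∈ A, c (w • x) = w * c x := by
  -- `c x` is the element carrying the chosen orbit representative to `x`; freeness makes it unique,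
  -- hence equivariant.
  let r : X → X := fun x => Quotient.out (Quotient.mk (MulAction.orbitRel F X) x)
  have hr : ∀ x, ∃ w : F, w • r x = x := fun x =>
    MulAction.orbitRel_apply.1 ((MulAction.orbitRel F X).symm
      (Quotient.exact (Quotient.out_eq (Quotient.mk (MulAction.orbitRel F X) x))))
  choose c hc using hr
  refine ⟨c, fun w x hx => ?_⟩
  have h1 : r (w • x) = r x :=
    congrArg Quotient.out (Quotient.sound (s := MulAction.orbitRel F X)
      (MulAction.orbitRel_apply.2 ⟨w, rfl⟩))
  have h2 := hc (w • x)
  have h3 : r x ∈ A := by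
    have := hinv (c x)⁻¹ x hx
    rwa [inv_smul_eq_iff.2 (hc x).symm] at this
  have h4 : ((w * c x)⁻¹ * c (w • x)) • r x = r x := by
    rw [mul_smul, ← h1, h2, inv_smul_eq_iff, mul_smul, h1, hc]
  exact (inv_mul_eq_one.1 (hfree _ h3 _ h4)).symm

open FreeGroup in
/-- An invariant set on which a free group of rank two acts freely contains two copies of
itself. -/
theorem containsTwoCopies_of_free {α : Type*} [DecidableEq α] {a b : α} (hab : a ≠ b)
    (φ : FreeGroup α →* G) {A : Set X} (hfree : ∀ x ∈ A, ∀ w, φ w • x = x → w = 1)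
    (hinv : ∀ w, ∀ x ∈ A, φ w • x ∈ A) : ContainsTwoCopies G A := by
  classical
  let _ : MulAction (FreeGroup α) X := MulAction.compHom X φ
  obtain ⟨c, hc⟩ := exists_equivariant (F := FreeGroup α) hfree hinv
  -- Words starting with `a⁻¹` stay put; left multiplication by `a` sends all others to words
  -- starting with `a`. So the image of `p a` only meets words starting with `a` or its inverse, and
  -- distinct letters give disjoint images.
  let p : α → X → X := fun a x =>
    if c x ∈ startsWith (a, false) then x else φ (mk [(a, true)]) • x
  have p1 : ∀ a x, c x ∈ startsWith (a, false) → p a x = x := fun a x h => if_pos h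
  have p2 : ∀ a x, c x ∉ startsWith (a, false) → p a x = φ (mk [(a, true)]) • x :=
    fun a x h => if_neg h
  have p3 : ∀ a, ∀ x ∈ A, c x ∉ startsWith (a, false) → c (p a x) ∈ startsWith (a, true) := by
    intro a x hx h
    rw [p2 a x h]
    have := startsWith_mk_mul (w := (a, true)) (c x) h
    rwa [← hc _ x hx] at this
  have hdisj : ∀ {u v : α × Bool} {w : FreeGroup α}, u ≠ v → w ∈ startsWith u →
      w ∉ startsWith v := fun h h1 =>
    (startsWith.disjoint_iff_ne.2 h).notMem_of_mem_left h1
  have hmaps : ∀ a, MapsTo (p a) A A := by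
    intro a x hx
    by_cases h : c x ∈ startsWith (a, false)
    · rwa [p1 a x h]
    · rw [p2 a x h]; exact hinv _ x hx
  have hinj : ∀ a, InjOn (p a) A := by
    intro a x hx y hy hxy
    by_cases h : c x ∈ startsWith (a, false) <;> by_cases h' : c y ∈ startsWith (a, false)
    · rwa [p1 a x h, p1 a y h'] at hxy
    · have h1 := p3 a y hy h'
      rw [← hxy, p1 a x h] at h1
      exact absurd h1 (hdisj (by simp) h)
    · have h1 := p3 a x hx h
      rw [hxy, p1 a y h'] at h1
      exact absurd h1 (hdisj (by simp) h')
    · rw [p2 a x h, p2 a y h'] at hxy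
      exact MulAction.injective _ hxy
  have hdec : ∀ a, ∀ S : Finset G, 1 ∈ S → φ (mk [(a, true)]) ∈ S →
      Equidecomp.IsDecompOn (p a) A S := by
    intro a S h1 h2 x _
    by_cases h : c x ∈ startsWith (a, false)
    · exact ⟨1, h1, by rw [p1 a x h, one_smul]⟩
    · exact ⟨_, h2, p2 a x h⟩
  have hstart : ∀ a, ∀ x ∈ A, ∃ s, c (p a x) ∈ startsWith (a, s) := by
    intro a x hx
    by_cases h : c x ∈ startsWith (a, false)
    · exact ⟨false, by rwa [p1 a x h]⟩
    · exact ⟨true, p3 a x hx h⟩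
  refine ⟨p a, p b, {1, φ (mk [(a, true)]), φ (mk [(b, true)])}, hdec a _ (by simp) (by simp),
    hdec b _ (by simp) (by simp), hmaps a, hmaps b, hinj a, hinj b, fun x hx y hy h => ?_⟩
  obtain ⟨s, hs⟩ := hstart a x hx
  obtain ⟨t, ht⟩ := hstart b y hy
  rw [← h] at ht
  exact hdisj (by simp [hab]) hs ht

end Abstract

/-! ### A free group of rotations -/

section FreeRotations

open Matrix

/-- Five times a rotation with cosine `3 / 5` about the third (`true`) or the first (`false`)
coordinate axis, or its inverse. -/
def rotInt : Bool × Bool → Matrix (Fin 3) (Fin 3) ℤ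
  | (true, true) => !![3, 4, 0; -4, 3, 0; 0, 0, 5]
  | (true, false) => !![3, -4, 0; 4, 3, 0; 0, 0, 5]
  | (false, true) => !![5, 0, 0; 0, 3, -4; 0, 4, 3]
  | (false, false) => !![5, 0, 0; 0, 3, 4; 0, -4, 3]

/-- The column factor of `rotInt x` modulo `5`, which has rank one. -/
def rotCol : Bool × Bool → Fin 3 → ZMod 5
  | (true, true) => ![3, 1, 0]
  | (true, false) => ![1, 3, 0]
  | (false, true) => ![0, 1, 3]
  | (false, false) => ![0, 3, 1]

theorem rotInt_mod_five (x : Bool × Bool) :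
    (rotInt x).map (Int.cast : ℤ → ZMod 5) = vecMulVec (rotCol x) (rotCol (x.1, !x.2)) := by
  revert x
  decide

/-- This is the scalar produced when two adjacent rank-one factors are multiplied; the hypothesis
says that the letters do not cancel. -/
theorem rotCol_dotProduct_ne_zero (x y : Bool × Bool) (h : x.1 = y.1 → x.2 = y.2) :
    rotCol (x.1, !x.2) ⬝ᵥ rotCol y ≠ 0 := by
  revert x y
  decide

theorem rotCol_ne_zero (x : Bool × Bool) : rotCol x ≠ 0 := by
  revert x
  decide

instance fact_prime_five : Fact (Nat.Prime 5) := ⟨by norm_num⟩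

theorem rotInt_prod_mod_five (L : List (Bool × Bool)) (x : Bool × Bool)
    (h : FreeGroup.IsReduced (x :: L)) :
    ∃ v : Fin 3 → ZMod 5, v ≠ 0 ∧
      ((x :: L).map fun y => (rotInt y).map (Int.cast : ℤ → ZMod 5)).prod
        = vecMulVec (rotCol x) v := by
  induction L generalizing x with
  | nil => exact ⟨_, rotCol_ne_zero (x.1, !x.2), by simp [rotInt_mod_five]⟩
  | cons y L ih =>
    obtain ⟨h1, h2⟩ := FreeGroup.isReduced_cons_cons.1 h
    obtain ⟨v, hv, hp⟩ := ih y h2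
    refine ⟨(rotCol (x.1, !x.2) ⬝ᵥ rotCol y) • v,
      smul_ne_zero (rotCol_dotProduct_ne_zero x y h1) hv, ?_⟩
    rw [List.map_cons, List.prod_cons, hp, rotInt_mod_five, vecMulVec_mul_vecMulVec]

theorem rotInt_prod_map_ne_zero {L : List (Bool × Bool)} (hL : L ≠ [])
    (h : FreeGroup.IsReduced L) :
    (L.map rotInt).prod.map (Int.cast : ℤ → ZMod 5) ≠ 0 := by
  obtain ⟨x, L, rfl⟩ := List.exists_cons_of_ne_nil hL
  obtain ⟨v, hv, hp⟩ := rotInt_prod_mod_five L x h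
  have h1 : ((x :: L).map rotInt).prod.map (Int.cast : ℤ → ZMod 5) = vecMulVec (rotCol x) v := by
    rw [← hp]
    have := map_list_prod (Int.castRingHom (ZMod 5)).mapMatrix ((x :: L).map rotInt)
    rw [List.map_map] at this
    exact this
  rw [h1]
  exact vecMulVec_ne_zero (rotCol_ne_zero x) hv

/-- The rotations underlying `rotInt`. -/
noncomputable def rotReal (x : Bool × Bool) : Matrix (Fin 3) (Fin 3) ℝ :=
  (1 / 5 : ℝ) • (rotInt x).map (Int.cast : ℤ → ℝ)

theorem rotReal_mul (x : Bool × Bool) : rotReal x * rotReal (x.1, !x.2) = 1 := by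
  have h : rotInt x * rotInt (x.1, !x.2) = 25 := by
    revert x
    decide
  have h1 := congrArg (Int.castRingHom ℝ).mapMatrix h
  rw [map_mul, map_ofNat] at h1
  have h2 : rotReal x * rotReal (x.1, !x.2) = (1 / 5 * (1 / 5) : ℝ) • 25 := by
    rw [← h1, rotReal, rotReal, smul_mul_smul_comm]
    rfl
  have h3 : (25 : Matrix (Fin 3) (Fin 3) ℝ) = (25 : ℝ) • 1 := by
    rw [ofNat_smul_eq_nsmul, nsmul_one, Nat.cast_ofNat]
  rw [h2, h3, smul_smul]
  norm_num

theorem rotReal_mem (x : Bool × Bool) : rotReal x ∈ specialOrthogonalGroup (Fin 3) ℝ := by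
  rw [mem_specialOrthogonalGroup_iff, mem_orthogonalGroup_iff]
  constructor
  · have h : (rotInt x)ᵀ = rotInt (x.1, !x.2) := by
      revert x
      decide
    have h1 : (rotReal x)ᵀ = rotReal (x.1, !x.2) := by
      rw [rotReal, rotReal, ← h]
      rfl
    rw [h1, rotReal_mul]
  · have h : (rotInt x).det = 125 := by
      revert x
      decide
    have h1 := RingHom.map_det (Int.castRingHom ℝ) (rotInt x)
    rw [h] at h1
    have h2 : ((rotInt x).map (Int.cast : ℤ → ℝ)).det = 125 := by
      rw [map_ofNat] at h1
      exact h1.symm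
    rw [rotReal, det_smul, h2]
    norm_num

/-- The homomorphism from the free group of rank two to `SO(3)` given by two rotations. -/
noncomputable def freeRot : FreeGroup Bool →* specialOrthogonalGroup (Fin 3) ℝ :=
  FreeGroup.lift fun b => ⟨rotReal (b, true), rotReal_mem _⟩

theorem coe_freeRot_mk (L : List (Bool × Bool)) :
    ((freeRot (FreeGroup.mk L) : specialOrthogonalGroup (Fin 3) ℝ) : Matrix (Fin 3) (Fin 3) ℝ)
      = (L.map rotReal).prod := by
  have h : ∀ x : Bool × Bool,
      (bif x.2 then (⟨rotReal (x.1, true), rotReal_mem _⟩ : specialOrthogonalGroup (Fin 3) ℝ)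
        else (⟨rotReal (x.1, true), rotReal_mem _⟩ : specialOrthogonalGroup (Fin 3) ℝ)⁻¹)
      = ⟨rotReal x, rotReal_mem x⟩ := by
    rintro ⟨b, _ | _⟩
    · exact inv_eq_of_mul_eq_one_right (Subtype.ext (rotReal_mul (b, true)))
    · rfl
  rw [freeRot, FreeGroup.lift_mk]
  simp_rw [h]
  rw [Submonoid.coe_list_prod, List.map_map]
  rfl

theorem pow_smul_rotReal_prod (L : List (Bool × Bool)) :
    (5 : ℝ) ^ L.length • (L.map rotReal).prod
      = (L.map rotInt).prod.map (Int.cast : ℤ → ℝ) := by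
  induction L with
  | nil => simp
  | cons x L ih =>
    have h : ((rotInt x * (L.map rotInt).prod).map (Int.cast : ℤ → ℝ))
        = (rotInt x).map (Int.cast : ℤ → ℝ) * (L.map rotInt).prod.map (Int.cast : ℤ → ℝ) :=
      Matrix.map_mul (f := Int.castRingHom ℝ)
    rw [List.map_cons, List.map_cons, List.prod_cons, List.prod_cons, h, ← ih, rotReal,
      List.length_cons, smul_mul_assoc, mul_smul_comm, smul_smul]
    congr 1
    rw [pow_succ, mul_assoc]
    norm_num

/-- A nonempty reduced word of length `n` acting trivially would have integer product `5 ^ n • 1`,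
which vanishes modulo 5. -/
theorem freeRot_injective : Function.Injective freeRot := by
  rw [injective_iff_map_eq_one]
  intro w hw
  by_contra hne
  have hL : w.toWord ≠ [] := fun h => hne (FreeGroup.toWord_eq_nil_iff.1 h)
  have h1 := pow_smul_rotReal_prod w.toWord
  rw [← coe_freeRot_mk, FreeGroup.mk_toWord, hw] at h1
  have h2 : (w.toWord.map rotInt).prod = (5 : ℤ) ^ w.toWord.length • 1 := by
    ext i j
    have := congrFun (congrFun h1 i) j
    simp only [OneMemClass.coe_one, Matrix.smul_apply, map_apply, one_apply, smul_eq_mul] at this ⊢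
    exact_mod_cast this.symm
  refine rotInt_prod_map_ne_zero hL FreeGroup.isReduced_toWord ?_
  rw [h2]
  ext i j
  have h5 : ((5 : ℤ) : ZMod 5) = 0 := by decide
  simp only [map_apply, Matrix.smul_apply, smul_eq_mul, Int.cast_mul, Int.cast_pow, h5, Matrix.zero_apply]
  rw [zero_pow (by simpa using hL), zero_mul]

end FreeRotations

/-! ### Rigid motions, axes and half-turns -/

section Motions

open Matrix

/-- The linear rigid motion given by an element of `SO(3)`. -/
noncomputable def linearMotion : specialOrthogonalGroup (Fin 3) ℝ →* G3 :=
  (MonoidHom.mk'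
    (fun A : specialOrthogonalGroup (Fin 3) ℝ =>
      ((⟨fun x => toEuclideanLin A.1 x, fun x => toEuclideanLin (A⁻¹).1 x,
        fun x => by
          have : (A⁻¹).1 * A.1 = 1 := congrArg Subtype.val (inv_mul_cancel A)
          simp only [toLpLin_apply, mulVec_mulVec, this, one_mulVec],
        fun x => by
          have : A.1 * (A⁻¹).1 = 1 := congrArg Subtype.val (mul_inv_cancel A)
          simp only [toLpLin_apply, mulVec_mulVec, this, one_mulVec]⟩ :
            Equiv.Perm E3)))
    (fun A B => by ext1 x; simp [toLpLin_apply])).codRestrict G3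
  (fun A => ⟨A.1, A.2, 0, fun x => by simp⟩)

theorem linearMotion_smul (A : specialOrthogonalGroup (Fin 3) ℝ) (x : E3) :
    linearMotion A • x = toEuclideanLin A.1 x := rfl

/-- Translation by `b` as an element of `G3`. -/
noncomputable def translation (b : E3) : G3 :=
  ⟨Equiv.addRight b, 1, one_mem _, b, fun x => by simp⟩

theorem translation_smul (b x : E3) : translation b • x = x + b := rfl

theorem norm_linearMotion_smul (A : specialOrthogonalGroup (Fin 3) ℝ) (x : E3) :
    ‖linearMotion A • x‖ = ‖x‖ := by
  have h : A.1ᵀ * A.1 = 1 :=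
    (mem_orthogonalGroup_iff' (Fin 3) ℝ).1 (mem_specialOrthogonalGroup_iff.1 A.2).1
  rw [linearMotion_smul, ← sq_eq_sq₀ (norm_nonneg _) (norm_nonneg _),
    EuclideanSpace.real_norm_sq_eq, EuclideanSpace.real_norm_sq_eq]
  have h1 : (A.1 *ᵥ x.ofLp) ⬝ᵥ (A.1 *ᵥ x.ofLp) = x.ofLp ⬝ᵥ x.ofLp := by
    rw [dotProduct_mulVec, vecMul_mulVec, h, vecMul_one]
  simpa [dotProduct, toLpLin_apply, sq] using h1

/-- For such `A` the adjugate is the transpose, so each entry equals its own cofactor, and cross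
products transform by cofactors. Used to see that the cross product of two fixed vectors is fixed.
-/
theorem cross_mulVec {A : Matrix (Fin 3) (Fin 3) ℝ} (hA : A ∈ specialOrthogonalGroup (Fin 3) ℝ)
    (v w : Fin 3 → ℝ) : A *ᵥ (crossProduct v w) = crossProduct (A *ᵥ v) (A *ᵥ w) := by
  obtain ⟨h1, h2⟩ := mem_specialOrthogonalGroup_iff.1 hA
  have h3 : Aᵀ * A = 1 := (mem_orthogonalGroup_iff' (Fin 3) ℝ).1 h1
  have h4 : adjugate A = Aᵀ := by
    have := congrArg (Aᵀ * ·) (mul_adjugate A)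
    simpa [← Matrix.mul_assoc, h3, h2] using this
  have h5 : ∀ i j, A j i = adjugate A i j := fun i j => by rw [h4]; rfl
  rw [adjugate_fin_three] at h5
  ext i
  have e0 := h5 0 i
  have e1 := h5 1 i
  have e2 := h5 2 i
  fin_cases i <;> simp [mulVec, dotProduct, Fin.sum_univ_three, cross_apply] at e0 e1 e2 ⊢ <;>
    rw [e0, e1, e2] <;> ring

/-- The fixed points of a nontrivial rotation lie on a line. -/
theorem exists_axis {A : specialOrthogonalGroup (Fin 3) ℝ} (hA : A ≠ 1) :
    ∃ d : E3, ∀ x : E3, linearMotion A • x = x → ∃ c : ℝ, x = c • d := by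
  have hfix : ∀ x : E3, linearMotion A • x = x ↔ A.1 *ᵥ x.ofLp = x.ofLp := by
    intro x
    rw [linearMotion_smul, toLpLin_apply]
    exact ⟨fun h => congrArg WithLp.ofLp h, fun h => congrArg (WithLp.toLp 2) h⟩
  -- If only 0 is fixed, any `d` serves, so the existence of an axis need not be proved.
  by_cases hd : ∀ x : E3, linearMotion A • x = x → x = 0
  · exact ⟨0, fun x hx => ⟨0, by simp [hd x hx]⟩⟩
  push Not at hd
  obtain ⟨d, hd, hd0⟩ := hd
  refine ⟨d, fun x hx => ?_⟩
  by_contra! hne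
  have hd0' : d.ofLp ≠ 0 := fun h => hd0 (WithLp.ofLp_injective 2 h)
  have hli : LinearIndependent ℝ ![d.ofLp, x.ofLp] :=
    (LinearIndependent.pair_iff' hd0').2 fun c h =>
      hne c (WithLp.ofLp_injective 2 (by simpa using h.symm))
  have hcross := crossProduct_ne_zero_iff_linearIndependent.2 hli
  have hd' := (hfix d).1 hd
  have hx' := (hfix x).1 hx
  set v := d.ofLp
  set w := x.ofLp
  have hn := cross_mulVec A.2 v w
  rw [hd', hx'] at hn
  set n := crossProduct v w with hndef
  -- The columns of `B` are fixed by `A`, and its determinant is `n ⬝ᵥ n`, which is nonzero; hence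
  -- `A = 1`.
  let B : Matrix (Fin 3) (Fin 3) ℝ := (Matrix.of ![n, v, w])ᵀ
  have hB : A.1 * B = B := by
    ext i j
    have e : ∀ j, (A.1 * B) i j = (A.1 *ᵥ (fun k => B k j)) i := fun j => rfl
    rw [e]
    fin_cases j
    · exact congrFun hn i
    · exact congrFun hd' i
    · exact congrFun hx' i
  have hdet : IsUnit B.det := by
    rw [isUnit_iff_ne_zero, det_transpose]
    have : (Matrix.of ![n, v, w]).det = n ⬝ᵥ n := (triple_product_eq_det n v w).symm
    rw [this]
    exact fun h => hcross (dotProduct_self_eq_zero.1 h)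
  apply hA
  apply Subtype.ext
  have := congrArg (· * B⁻¹) hB
  simpa [Matrix.mul_assoc, mul_nonsing_inv B hdet] using this

/-- The half-turn about the line spanned by a nonzero vector `u`. -/
theorem exists_halfTurn {u : E3} (hu : u ≠ 0) :
    ∃ A : specialOrthogonalGroup (Fin 3) ℝ,
      ∀ x : E3, linearMotion A • x = (2 * inner ℝ u x / ‖u‖ ^ 2) • u - x := by
  have hN : ‖u‖ ^ 2 ≠ 0 := by positivity
  have hN' := EuclideanSpace.real_norm_sq_eq u
  rw [Fin.sum_univ_three] at hN'
  set N := ‖u‖ ^ 2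
  have hmem : ((2 / N) • vecMulVec u.ofLp u.ofLp - 1 : Matrix (Fin 3) (Fin 3) ℝ) ∈
      specialOrthogonalGroup (Fin 3) ℝ := by
    rw [mem_specialOrthogonalGroup_iff, mem_orthogonalGroup_iff]
    constructor
    · have h1 : ((2 / N) • vecMulVec u.ofLp u.ofLp - 1 : Matrix (Fin 3) (Fin 3) ℝ)ᵀ
          = (2 / N) • vecMulVec u.ofLp u.ofLp - 1 := by
        simp
      have h2 : u.ofLp ⬝ᵥ u.ofLp = N := by
        rw [hN', dotProduct, Fin.sum_univ_three]; ring
      rw [h1, mul_sub, sub_mul, smul_mul_smul_comm, vecMulVec_mul_vecMulVec, h2, vecMulVec_smul,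
        smul_smul, mul_one, one_mul]
      have h3 : 2 / N * (2 / N) * N = 2 / N + 2 / N := by
        field_simp
        norm_num
      rw [h3, add_smul]
      abel
    · simp only [det_fin_three, Matrix.sub_apply, Matrix.smul_apply, vecMulVec_apply, smul_eq_mul, one_apply]
      simp
      field_simp
      rw [hN']
      ring
  refine ⟨⟨_, hmem⟩, fun x => ?_⟩
  rw [linearMotion_smul]
  ext i
  simp [toLpLin_apply, vecMulVec_mulVec,
    EuclideanSpace.inner_eq_star_dotProduct]
  rw [dotProduct_comm]
  ring

end Motions

/-! ### Absorbing the axes and the origin -/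

section Paradox

open MeasureTheory in
/-- Countably many lines through the origin are moved off each other by a suitable rotation. -/
theorem exists_rotation_disjoint {ι : Type*} [Countable ι] (d : ι → E3) :
    ∃ A : Matrix.specialOrthogonalGroup (Fin 3) ℝ, ∀ x : E3, x ≠ 0 → ∀ i j, ∀ c c' : ℝ,
      x = c • d i → linearMotion A • x ≠ c' • d j := by
  -- The half-turn axis `u` must avoid countably many proper subspaces, each of measure zero: the
  -- spans of pairs of lines and the orthogonal complements of single lines.
  have h1 : ∀ i j, ∀ᵐ u : E3, u ∉ Submodule.span ℝ {d i, d j} := fun i j => by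
    refine measure_eq_zero_iff_ae_notMem.1 (Measure.addHaar_submodule volume _ fun h => ?_)
    have h2 := finrank_span_le_card (R := ℝ) ({d i, d j} : Set E3)
    have h3 : ({d i, d j} : Set E3).toFinset.card ≤ 2 := by
      classical
      simpa using Finset.card_le_two (a := d i) (b := d j)
    rw [h, finrank_top, finrank_euclideanSpace_fin] at h2
    omega
  have h2 : ∀ i, ∀ᵐ u : E3, d i ≠ 0 → u ∉ (Submodule.span ℝ {d i})ᗮ := fun i => by
    by_cases hi : d i = 0
    · simp [hi]
    · simp only [ne_eq, hi, not_false_eq_true, forall_const]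
      refine measure_eq_zero_iff_ae_notMem.1 (Measure.addHaar_submodule volume _ fun h => ?_)
      rw [Submodule.orthogonal_eq_top_iff, Submodule.span_singleton_eq_bot] at h
      exact hi h
  have h3 : ∀ᵐ u : E3, u ≠ 0 := by
    simp [ae_iff]
  obtain ⟨u, hu1, hu2, hu⟩ := ((ae_all_iff.2 fun i => ae_all_iff.2 (h1 i)).and
    ((ae_all_iff.2 h2).and h3)).exists
  obtain ⟨A, hA⟩ := exists_halfTurn hu
  refine ⟨A, fun x hx i j c c' hc hc' => ?_⟩
  have hdi : d i ≠ 0 := fun h => hx (by rw [hc, h, smul_zero])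
  have hc0 : c ≠ 0 := fun h => hx (by rw [hc, h, zero_smul])
  have hin : inner ℝ u x ≠ 0 := by
    rw [hc, inner_smul_right]
    refine mul_ne_zero hc0 fun h => hu2 i hdi ?_
    rwa [Submodule.mem_orthogonal_singleton_iff_inner_left]
  -- The half-turn sends `x` to `t • u - x` with `t ≠ 0`; if this lay on the line of `d j`, then `u`
  -- would lie in the span of `d i` and `d j`.
  have ht : 2 * inner ℝ u x / ‖u‖ ^ 2 ≠ 0 := by positivity
  rw [hA, sub_eq_iff_eq_add] at hc'
  refine hu1 i j ?_
  rw [← Submodule.smul_mem_iff _ ht, hc', hc]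
  exact add_mem (Submodule.smul_mem _ _ (Submodule.subset_span (by simp)))
    (Submodule.smul_mem _ _ (Submodule.subset_span (by simp)))

/-- The points with nontrivial stabilizer under the free group of rotations. -/
def singularSet : Set E3 := {x | ∃ w, w ≠ 1 ∧ linearMotion (freeRot w) • x = x}

theorem zero_mem_singularSet : (0 : E3) ∈ singularSet :=
  ⟨FreeGroup.of true, FreeGroup.of_ne_one _, by simp [linearMotion_smul]⟩

/-- Stabilizers along an orbit are conjugate. -/
theorem smul_notMem_singularSet (w : FreeGroup Bool) {x : E3} (hx : x ∉ singularSet) :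
    linearMotion (freeRot w) • x ∉ singularSet := by
  rintro ⟨v, hv, h⟩
  refine hx ⟨w⁻¹ * v * w, fun h1 => hv ?_, ?_⟩
  · rw [mul_assoc, inv_mul_eq_one] at h1
    exact right_eq_mul.1 h1
  · simp only [map_mul, map_inv, mul_smul, h, inv_smul_smul]

/-- The free group is countable and each nontrivial word has its fixed points on one line. The
origin is excluded because every rotation fixes it. -/
theorem exists_rotation_singularSet :
    ∃ A : Matrix.specialOrthogonalGroup (Fin 3) ℝ, ∀ x ∈ singularSet, x ≠ 0 →
      linearMotion A • x ∉ singularSet := by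
  have h : ∀ w : {w : FreeGroup Bool // w ≠ 1}, ∃ d : E3, ∀ x : E3,
      linearMotion (freeRot w) • x = x → ∃ c : ℝ, x = c • d := fun w =>
    exists_axis fun h => w.2 (freeRot_injective (h.trans (map_one _).symm))
  choose d hd using h
  obtain ⟨A, hA⟩ := exists_rotation_disjoint d
  refine ⟨A, ?_⟩
  rintro x ⟨w, hw, hx⟩ hx0 ⟨v, hv, hx'⟩
  obtain ⟨c, hc⟩ := hd ⟨w, hw⟩ x hx
  obtain ⟨c', hc'⟩ := hd ⟨v, hv⟩ _ hx'
  exact hA x hx0 _ _ c c' hc hc'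

theorem containsTwoCopies_ball_diff_singularSet :
    ContainsTwoCopies G3 (Metric.closedBall (0 : E3) 1 \ singularSet) := by
  refine containsTwoCopies_of_free (a := true) (b := false) (by simp)
    (linearMotion.comp freeRot) ?_ ?_
  · intro x hx w hw
    by_contra h
    exact hx.2 ⟨w, h, hw⟩
  · intro w x hx
    refine ⟨?_, smul_notMem_singularSet w hx.2⟩
    rw [mem_closedBall_zero_iff, MonoidHom.comp_apply, norm_linearMotion_smul]
    exact mem_closedBall_zero_iff.1 hx.1

theorem containsTwoCopies_ball_diff_zero :
    ContainsTwoCopies G3 (Metric.closedBall (0 : E3) 1 \ {0}) := by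
  obtain ⟨A, hA⟩ := exists_rotation_singularSet
  refine containsTwoCopies_ball_diff_singularSet.of_diff (k := fun x => linearMotion A • x)
    (T := {linearMotion A}) ?_ (fun x _ => ⟨_, Finset.mem_singleton_self _, rfl⟩) ?_
    (MulAction.injective _).injOn
  · exact sdiff_subset_sdiff_right (singleton_subset_iff.2 zero_mem_singularSet)
  · rintro x ⟨⟨hx, hx0⟩, h⟩
    have hxs : x ∈ singularSet := by
      by_contra hxs
      exact h ⟨hx, hxs⟩
    refine ⟨?_, hA x hxs hx0⟩
    rw [mem_closedBall_zero_iff, norm_linearMotion_smul]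
    exact mem_closedBall_zero_iff.1 hx

theorem containsTwoCopies_ball : ContainsTwoCopies G3 (Metric.closedBall (0 : E3) 1) := by
  have hdiff : Metric.closedBall (0 : E3) 1 \ (Metric.closedBall (0 : E3) 1 \ {0}) ⊆ {0} :=
    fun x hx => by_contra fun h => hx.2 ⟨hx.1, h⟩
  -- Any nonzero vector of the ball would do: only the origin remains to be moved.
  let p : E3 := EuclideanSpace.single 0 1
  refine containsTwoCopies_ball_diff_zero.of_diff (k := fun x => translation p • x)
    (T := {translation p}) sdiff_subset (fun x _ => ⟨_, Finset.mem_singleton_self _, rfl⟩) ?_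
    (MulAction.injective _).injOn
  intro x hx
  have hp : ‖p‖ = 1 := by simp [p]
  have hpx : translation p • x = p := by rw [hdiff hx, translation_smul, zero_add]
  change translation p • x ∈ _
  rw [hpx]
  refine ⟨by rw [mem_closedBall_zero_iff, hp], ?_⟩
  exact norm_ne_zero_iff.1 (hp ▸ one_ne_zero)

end Paradox

end BanachTarski

theorem mainTheorem2 :
    BanachTarski.IsParadoxical BanachTarski.G3
      (Metric.closedBall (0 : BanachTarski.E3) 1) :=
  BanachTarski.containsTwoCopies_ball.isParadoxical (Metric.nonempty_closedBall.2 zero_le_one)
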